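/- Let $k,n,m$ be integers with $1\le k<n$ and $m\ge 0$. For $k_1,k_2\in\mathbb Z$ let $\mathrm{Li}_{k_1,k_2}(z)=\sum_{0<m_1<m_2}\frac{z^{m_2}}{m_1^{k_1}m_2^{k_2}}$ for $|z|<1$; the function $\mathrm{Li}_{k,-n}$ continues analytically to $\mathbb C\setminus[1,\infty)$, and its continuation is denoted by the same symbol. For $\Re(s)>0$ put $$\widetilde\xi(k,-n;s)=\frac1{\Gamma(s)}\int_0^\infty t^{s-1}\,\frac{\mathrm{Li}_{k,-n}(1-e^t)}{e^{-t}-1}\,dt .$$ For positive integers $p_1,\dots,p_d$ with $p_d\ge2$ and reals $\alpha_1,\dots,\alpha_d>0$ put $$\zeta^\star(p_1,\dots,p_d;\alpha_1,\dots,\alpha_d)=\sum_{0\le m_1\le\cdots\le m_d}\ \prod_{i=1}^d\frac1{(m_i+\alpha_i)^{p_i}},$$ and write $\{\alpha\}^d=(\alpha,\dots,\alpha)$ ($d$ entries). Let $\mathcal E_0(z)=z$ and, for $i\ge1$, let $$\mathcal E_i(z)=\sum_{j=0}^{i-1}\sum_{l=0}^{j+1}(-1)^l\binom{i+1}{l}(j-l+1)^i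 z^{i-j}$$ be the Eulerian polynomials. Define polynomials with integer coefficients by $$P'_{n-l-1}(z)=\binom nl\frac{\mathcal E_{n-l}(z)}{z}\quad(0\le l\le k-1),\qquad P'_{n-k-1}(z)=\sum_{i=k}^n\binom ni\frac{\mathcal E_{n-i}(z)\,\mathcal E_{i-k}(z)}{z^2},$$ and define integers $A'^{(n)}_{l,j}$ (for $0\le l\le k$, $0\le j\le n-l-1$; they depend only on $k,n,l,j$) by $P'_{n-l-1}(z)=\sum_{j=0}^{n-l-1}A'^{(n)}_{l,j}(1-z)^j$. Then the integral defining $\widetilde\xi(k,-n;m+1)$ converges absolutely, and $$\begin{aligned}\widetilde\xi(k,-n;m+1)=&-\sum_{l=0}^{k-2}\sum_{j=0}^{n-l-1}\ \sum_{\substack{a_{l+1}+\cdots+a_k=m\\ a_i\ge0}}A'^{(n)}_{l,j}\,\frac{a_k+1}{(n-l-j)^{a_{l+1}+1}}\,\zeta^\star\bigl(a_{l+2}+1,\dots,a_{k-1}+1,a_k+2;\{n-l-j\}^{k-l-1}\bigr)\\&-\sum_{j=0}^{n-k}A'^{(n)}_{k-1,j}\,\frac{m+1}{(n-k-j+1)^{m+2}}\\&-\sum_{j=0}^{n-k-1}A'^{(n)}_{k,j}\left(\frac1{(n-k-j)^{m+1}}-\frac1{(n-k-j+1)^{m+1}}\right).\end{aligned}$$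 -/

import Mathlib

open MeasureTheory Set Polynomial

noncomputable section

/-- The double polylogarithm series
`Li_{k₁,k₂}(z) = ∑_{0 < m₁ < m₂} z^{m₂} / (m₁^{k₁} m₂^{k₂})`, for integer indices and `|z| < 1`. -/
def doublePolylogSeries (k₁ k₂ : ℤ) (z : ℂ) : ℂ :=
  ∑' p : {p : ℕ × ℕ // 0 < p.1 ∧ p.1 < p.2},
    z ^ p.1.2 / ((p.1.1 : ℂ) ^ k₁ * (p.1.2 : ℂ) ^ k₂)

/-- The plane cut along the real half-line `[1, ∞)`. -/
def cutPlane : Set ℂ := {z : ℂ | ¬ (1 ≤ z.re ∧ z.im = 0)}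

/-- `F` is the analytic continuation of `Li_{k₁,k₂}` to the cut plane. As the cut plane is
connected, the values of `F` there are determined by this property. -/
def IsDoublePolylogContinuation (k₁ k₂ : ℤ) (F : ℂ → ℂ) : Prop :=
  AnalyticOnNhd ℂ F cutPlane ∧ ∀ z : ℂ, ‖z‖ < 1 → F z = doublePolylogSeries k₁ k₂ z

/-- `Li_{k₁,k₂}`, analytically continued to the plane cut along `[1, ∞)`. -/
def doublePolylog (k₁ k₂ : ℤ) : ℂ → ℂ :=
  Classical.epsilon (IsDoublePolylogContinuation k₁ k₂)

/-- The integrand `t^{s-1} Li_{k,-n}(1 - e^t) / (e^{-t} - 1)`. -/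
def xiTildeIntegrand (k n : ℕ) (s : ℂ) (t : ℝ) : ℂ :=
  (t : ℂ) ^ (s - 1) *
    (doublePolylog (k : ℤ) (-(n : ℤ)) (1 - Complex.exp (t : ℂ)) / (Complex.exp (-(t : ℂ)) - 1))

/-- `ξ̃(k,-n;s) = Γ(s)⁻¹ ∫₀^∞ t^{s-1} Li_{k,-n}(1 - e^t) / (e^{-t} - 1) dt`. -/
def xiTilde (k n : ℕ) (s : ℂ) : ℂ :=
  1 / Complex.Gamma s * ∫ t in Ioi (0 : ℝ), xiTildeIntegrand k n s t

/-- The multiple Hurwitz zeta star value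
`ζ⋆(p₁,…,p_d; α₁,…,α_d) = ∑_{0 ≤ m₁ ≤ ⋯ ≤ m_d} ∏ᵢ 1 / (mᵢ + αᵢ)^{pᵢ}`. -/
def hurwitzZetaStar {d : ℕ} (p : Fin d → ℕ) (α : Fin d → ℝ) : ℝ :=
  ∑' m : {m : Fin d → ℕ // Monotone m}, ∏ i, 1 / ((m.1 i : ℝ) + α i) ^ p i

/-- The Eulerian polynomial divided by its factor `z`: `eulerianQuot i = ℰᵢ(z) / z`, where
`ℰ₀(z) = z` and `ℰᵢ(z) = ∑_{j=0}^{i-1} ∑_{l=0}^{j+1} (-1)^l C(i+1,l) (j-l+1)^i z^{i-j}` for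
`i ≥ 1`, so that `∑_{m ≥ 1} m^i z^m = ℰᵢ(z) / (1-z)^{i+1}`. -/
def eulerianQuot : ℕ → ℤ[X]
  | 0 => 1
  | i + 1 => ∑ j ∈ Finset.range (i + 1), ∑ l ∈ Finset.range (j + 2),
      C ((-1) ^ l * ((i + 2).choose l : ℤ) * ((j : ℤ) - l + 1) ^ (i + 1)) * X ^ (i - j)

/-- The polynomial `P'_{n-l-1}` (for `0 ≤ l ≤ k < n`), i.e. the numerator belonging to `Li_{k-l}`
in `Li_{k,-n}(z) = z ∑_{l=0}^{k} P'_{n-l-1}(z) (1-z)^{-(n-l+1)} Li_{k-l}(z)`. -/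
def polyP' (k n l : ℕ) : ℤ[X] :=
  if l < k then C (n.choose l : ℤ) * eulerianQuot (n - l)
  else ∑ i ∈ Finset.Icc k n, C (n.choose i : ℤ) * eulerianQuot (n - i) * eulerianQuot (i - k)

/-- The integers `A'_{l,j}`: the coefficients in `P'_{n-l-1}(z) = ∑_j A'_{l,j} (1-z)^j`. -/
def coeffA' (k n l j : ℕ) : ℤ :=
  ((polyP' k n l).comp (1 - X)).coeff j

end

open MeasureTheory Set Polynomial

noncomputable section

/-! ### The functions `Li_r(z) / z` on the cut plane -/

/-! For `‖z‖ < 1` put `m₁ = a + 1`, `m₂ = (a + 1) + (b + 1)` and expand `m₂ ^ n` by the binomial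
theorem. The double series becomes a finite sum of products of one-variable series, each a
polylogarithm or an Eulerian rational function. This gives `doublePolylogClosed`, analytic on the
cut plane, and the identity theorem extends the equality there (`doublePolylog_eq_closed`).

At `z = 1 - exp t` powers of `1 - z` are exponentials, so the integrand over `m!` is a combination
of `t ^ m / m! * exp (-s t) * W_r(t)` with `W_r(t) = -Li_{r+1}(1 - exp t)`, `r = k - l - 1`, `s = n
- l - j`, plus pure Gamma integrands from `l = k`.

Let `I_d(m, s)` be the integral with `W_d`. Since `W_{d+1}' = W_d / (1 - exp (-u)) = ∑_q exp (-q u)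
W_d`, integrating by parts (as Tonelli) gives `I_{d+1}(m, s) = ∑_{p₁+p₂=m} s^{-(p₁+1)} ∑_q I_d(p₂, s
+ q)` (`negPolylogIntegral_succ`). Splitting off the smallest index of `ζ⋆` gives a matching
recursion (`hurwitzZetaStarENN_succ`), and `I_0` is a Gamma integral. The recursion runs in `[0,
∞]`, where sums and integrals commute freely; `W_d(t) ≤ (1 + t)^(d+1)` supplies finiteness. -/

lemma mem_cutPlane {z : ℂ} : z ∈ cutPlane ↔ ¬ (1 ≤ z.re ∧ z.im = 0) := Iff.rfl

lemma isOpen_cutPlane : IsOpen cutPlane := by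
  have h : IsClosed {z : ℂ | 1 ≤ z.re ∧ z.im = 0} :=
    (isClosed_le continuous_const Complex.continuous_re).inter
      (isClosed_eq Complex.continuous_im continuous_const)
  exact h.isOpen_compl

lemma ofReal_mul_mem_cutPlane {z : ℂ} (hz : z ∈ cutPlane) {u : ℝ} (hu : u ∈ Icc (0 : ℝ) 1) :
    (u : ℂ) * z ∈ cutPlane := by
  rw [mem_cutPlane] at *
  rintro ⟨h1, h2⟩
  simp only [Complex.mul_re, Complex.ofReal_re, Complex.ofReal_im, zero_mul, sub_zero,
    Complex.mul_im, add_zero] at h1 h2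
  have hu0 : u ≠ 0 := by rintro rfl; norm_num at h1
  refine hz ⟨?_, (mul_eq_zero.1 h2).resolve_left hu0⟩
  have hre : 0 < z.re := by
    by_contra! h
    nlinarith [mul_nonpos_of_nonneg_of_nonpos hu.1 h]
  nlinarith [hu.2]

lemma zero_mem_cutPlane : (0 : ℂ) ∈ cutPlane := by simp [mem_cutPlane]

lemma isPreconnected_cutPlane : IsPreconnected cutPlane := by
  have h : StarConvex ℝ (0 : ℂ) cutPlane := by
    rw [starConvex_zero_iff]
    intro z hz u h0 h1
    show u • z ∈ cutPlane
    simpa using ofReal_mul_mem_cutPlane hz ⟨h0, h1⟩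
  exact (h.isPathConnected zero_mem_cutPlane).isConnected.isPreconnected

lemma one_sub_ne_zero_of_mem_cutPlane {z : ℂ} (hz : z ∈ cutPlane) : 1 - z ≠ 0 := by
  intro h
  rw [sub_eq_zero] at h
  exact hz (by simp [← h])

lemma mem_cutPlane_of_norm_lt_one {z : ℂ} (hz : ‖z‖ < 1) : z ∈ cutPlane :=
  fun h => absurd (h.1.trans (Complex.re_le_norm z)) (not_le.2 hz)

lemma ofReal_mem_cutPlane {x : ℝ} (hx : x ≤ 0) : (x : ℂ) ∈ cutPlane := by
  rw [mem_cutPlane]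
  rintro ⟨h, -⟩
  rw [Complex.ofReal_re] at h
  linarith

/-- The cut plane is star-shaped about `0`, so the segments from `0` to a small closed ball sweep
out a compact subset. There `deriv f` is bounded, which permits differentiation under the integral.
-/
lemma differentiableOn_integral_ofReal_mul {f : ℂ → ℂ} (hf : DifferentiableOn ℂ f cutPlane) :
    DifferentiableOn ℂ (fun z => ∫ u in (0 : ℝ)..1, f (u * z)) cutPlane := by
  intro z₀ hz₀
  obtain ⟨ε, hε, hball⟩ := Metric.nhds_basis_closedBall.mem_iff.1 (isOpen_cutPlane.mem_nhds hz₀)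
  set K : Set ℂ := (fun p : ℝ × ℂ => (p.1 : ℂ) * p.2) '' (Icc (0 : ℝ) 1 ×ˢ Metric.closedBall z₀ ε)
  have hK : IsCompact K :=
    (isCompact_Icc.prod (isCompact_closedBall z₀ ε)).image (by fun_prop)
  have hKsub : K ⊆ cutPlane := by
    rintro _ ⟨p, ⟨hp1, hp2⟩, rfl⟩
    exact ofReal_mul_mem_cutPlane (hball hp2) hp1
  have hd : ContinuousOn (deriv f) cutPlane := (hf.deriv isOpen_cutPlane).continuousOn
  obtain ⟨B, hB⟩ := hK.exists_bound_of_continuousOn (hd.mono hKsub)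
  have hline : ∀ z ∈ cutPlane, ∀ g : ℂ → ℂ, ContinuousOn g cutPlane →
      ContinuousOn (fun u : ℝ => g (u * z)) (Icc 0 1) := by
    intro z hz g hg
    exact hg.comp (by fun_prop) fun u hu => ofReal_mul_mem_cutPlane hz hu
  have hmeas : ∀ z ∈ cutPlane, ∀ g : ℂ → ℂ, ContinuousOn g cutPlane →
      AEStronglyMeasurable (fun u : ℝ => g (u * z)) (volume.restrict (uIoc (0 : ℝ) 1)) := by
    intro z hz g hg
    rw [uIoc_of_le zero_le_one]
    exact ((hline z hz g hg).mono Ioc_subset_Icc_self).aestronglyMeasurable measurableSet_Ioc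
  have key := intervalIntegral.hasDerivAt_integral_of_dominated_loc_of_deriv_le
    (μ := volume) (a := 0) (b := 1) (F := fun (z : ℂ) (u : ℝ) => f (u * z))
    (F' := fun (z : ℂ) (u : ℝ) => deriv f (u * z) * u) (x₀ := z₀)
    (s := Metric.ball z₀ ε) (bound := fun _ => B) (Metric.ball_mem_nhds _ hε)
    (by
      filter_upwards [isOpen_cutPlane.mem_nhds hz₀] with z hz
      exact hmeas z hz f hf.continuousOn)
    (by
      apply ContinuousOn.intervalIntegrable
      rw [uIcc_of_le zero_le_one]
      exact hline z₀ hz₀ f hf.continuousOn)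
    ((hmeas z₀ hz₀ _ hd).mul Complex.continuous_ofReal.aestronglyMeasurable)
    (by
      refine Filter.Eventually.of_forall fun u hu z hz => ?_
      rw [uIoc_of_le zero_le_one] at hu
      have h1 := hB _ ⟨(u, z), ⟨Ioc_subset_Icc_self hu, Metric.ball_subset_closedBall hz⟩, rfl⟩
      rw [norm_mul, Complex.norm_real, Real.norm_of_nonneg hu.1.le]
      exact (mul_le_of_le_one_right (norm_nonneg _) hu.2).trans h1)
    (by simp)
    (by
      refine Filter.Eventually.of_forall fun u hu z hz => ?_
      rw [uIoc_of_le zero_le_one] at hu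
      have hz' : (u : ℂ) * z ∈ cutPlane :=
        ofReal_mul_mem_cutPlane (hball (Metric.ball_subset_closedBall hz))
          (Ioc_subset_Icc_self hu)
      have h1 := (hf.differentiableAt (isOpen_cutPlane.mem_nhds hz')).hasDerivAt
      have h2 : HasDerivAt (fun z : ℂ => (u : ℂ) * z) u z := by
        simpa using (hasDerivAt_id z).const_mul (u : ℂ)
      exact h1.comp z h2)
  exact key.2.differentiableAt.differentiableWithinAt

/-- `Li_r(z) / z`, on the cut plane. -/
def polylogQuot : ℕ → ℂ → ℂ
  | 0 => fun z => (1 - z)⁻¹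
  | r + 1 => fun z => ∫ u in (0 : ℝ)..1, polylogQuot r (u * z)

/-- The restriction of `polylogQuot` to the real axis. -/
def polylogQuotReal : ℕ → ℝ → ℝ
  | 0 => fun x => (1 - x)⁻¹
  | r + 1 => fun x => ∫ u in (0 : ℝ)..1, polylogQuotReal r (u * x)

lemma polylogQuot_ofReal (r : ℕ) (x : ℝ) : polylogQuot r x = (polylogQuotReal r x : ℂ) := by
  induction r generalizing x with
  | zero => simp [polylogQuot, polylogQuotReal]
  | succ r ih =>
    simp only [polylogQuot, polylogQuotReal]
    rw [← intervalIntegral.integral_ofReal]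
    congr 1
    ext u
    rw [← ih, Complex.ofReal_mul]

lemma differentiableOn_polylogQuot (r : ℕ) : DifferentiableOn ℂ (polylogQuot r) cutPlane := by
  induction r with
  | zero =>
    intro z hz
    have h := one_sub_ne_zero_of_mem_cutPlane hz
    exact DifferentiableAt.differentiableWithinAt
      (((differentiableAt_const _).sub differentiableAt_id).inv h)
  | succ r ih => exact differentiableOn_integral_ofReal_mul ih

lemma continuousOn_polylogQuotReal (r : ℕ) : ContinuousOn (polylogQuotReal r) (Iic 0) := by
  have h : ContinuousOn (fun x : ℝ => (polylogQuot r x).re) (Iic 0) :=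
    Complex.continuous_re.comp_continuousOn
      ((differentiableOn_polylogQuot r).continuousOn.comp Complex.continuous_ofReal.continuousOn
        fun x hx => ofReal_mem_cutPlane hx)
  exact h.congr fun x _ => by simp only [polylogQuot_ofReal, Complex.ofReal_re]

lemma polylogQuotReal_nonneg (r : ℕ) {x : ℝ} (hx : x ≤ 0) : 0 ≤ polylogQuotReal r x := by
  induction r generalizing x with
  | zero => exact inv_nonneg.2 (by linarith)
  | succ r ih =>
    exact intervalIntegral.integral_nonneg zero_le_one fun u hu =>
      ih (mul_nonpos_of_nonneg_of_nonpos hu.1 hx)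

/-- Termwise integration: `∫₀¹ u ^ m du = 1 / (m + 1)` raises the exponent by one, with `‖z‖ ^ m` as
summable dominant. -/
lemma hasSum_polylogQuot (r : ℕ) {z : ℂ} (hz : ‖z‖ < 1) :
    HasSum (fun m : ℕ => z ^ m / ((m : ℂ) + 1) ^ r) (polylogQuot r z) := by
  induction r generalizing z with
  | zero => simpa [polylogQuot] using hasSum_geometric_of_norm_lt_one hz
  | succ r ih =>
    have hle : ∀ m : ℕ, (1 : ℝ) ≤ ‖((m : ℂ) + 1) ^ r‖ := by
      intro m
      rw [norm_pow]
      apply one_le_pow₀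
      rw [← Nat.cast_succ, Complex.norm_natCast]
      simp
    have h := intervalIntegral.hasSum_integral_of_dominated_convergence
      (μ := volume) (a := 0) (b := 1) (F := fun (m : ℕ) (u : ℝ) => (u * z) ^ m / ((m : ℂ) + 1) ^ r)
      (f := fun u : ℝ => polylogQuot r (u * z)) (fun m _ => ‖z‖ ^ m)
      (fun m => by
        apply Continuous.aestronglyMeasurable
        fun_prop)
      (fun m => by
        refine Filter.Eventually.of_forall fun u hu => ?_
        rw [uIoc_of_le zero_le_one] at hu
        rw [norm_div, norm_pow, norm_mul, Complex.norm_real, Real.norm_of_nonneg hu.1.le]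
        refine (div_le_self (by positivity [hu.1.le]) (hle m)).trans ?_
        exact pow_le_pow_left₀ (mul_nonneg hu.1.le (norm_nonneg _))
          (mul_le_of_le_one_left (norm_nonneg _) hu.2) m)
      (Filter.Eventually.of_forall fun u _ =>
        summable_geometric_of_lt_one (norm_nonneg _) hz)
      (by simp)
      (by
        refine Filter.Eventually.of_forall fun u hu => ?_
        rw [uIoc_of_le zero_le_one] at hu
        apply ih
        rw [norm_mul, Complex.norm_real, Real.norm_of_nonneg hu.1.le]
        exact (mul_le_of_le_one_left (norm_nonneg _) hu.2).trans_lt hz)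
    convert! h using 1
    ext m
    have e : ∀ u : ℝ, ((u : ℂ) * z) ^ m / ((m : ℂ) + 1) ^ r =
        ((u ^ m : ℝ) : ℂ) * (z ^ m / ((m : ℂ) + 1) ^ r) := by
      intro u
      push_cast
      ring
    simp only [e]
    rw [intervalIntegral.integral_mul_const, intervalIntegral.integral_ofReal, integral_pow]
    push_cast
    simp only [one_pow, ne_eq, Nat.add_eq_zero_iff, one_ne_zero, and_false, not_false_eq_true,
      zero_pow, sub_zero]
    have hm : (m : ℂ) + 1 ≠ 0 := by exact_mod_cast Nat.succ_ne_zero m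
    field_simp
    ring

/-! ### Eulerian polynomials -/

/-- The coefficient of `z ^ N` in `(1 - z) ^ (a + 1) * ∑ r ^ a z ^ r`. -/
def eulerianCoeff (a N : ℕ) : ℤ :=
  ∑ l ∈ Finset.range (N + 1), (-1) ^ l * ((a + 1).choose l : ℤ) * ((N : ℤ) - l) ^ a

/-- The `(a + 1)`-st finite difference of a polynomial of degree `a` vanishes. -/
lemma sum_alternating_choose_mul_sub_pow (a : ℕ) (x : ℤ) :
    ∑ l ∈ Finset.range (a + 2), (-1) ^ l * ((a + 1).choose l : ℤ) * (x - l) ^ a = 0 := by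
  have h := congrFun (fwdDiff_iter_pow_eq_zero_of_lt (R := ℤ) (Nat.lt_succ_self a)) (-x)
  rw [fwdDiff_iter_eq_sum_shift] at h
  simp only [Pi.zero_apply, smul_eq_mul, nsmul_eq_mul, mul_one] at h
  have h2 : ∑ l ∈ Finset.range (a + 2), (-1) ^ l * ((a + 1).choose l : ℤ) * (x - l) ^ a =
      - ∑ k ∈ Finset.range (a + 1 + 1), (-1) ^ (a + 1 - k) * ((a + 1).choose k : ℤ) * (-x + k) ^ a := by
    rw [← Finset.sum_neg_distrib]
    refine Finset.sum_congr rfl fun l hl => ?_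
    have hl' : l ≤ a + 1 := by rw [Finset.mem_range] at hl; omega
    obtain ⟨c, hc⟩ := Nat.exists_eq_add_of_le hl'
    have e1 : a + 1 - l = c := by omega
    have e2 : (-x + (l : ℤ)) = (-1) * (x - l) := by ring
    rw [e1, e2, mul_pow]
    have e3 : ((-1 : ℤ)) ^ l = - ((-1) ^ c * (-1) ^ a) := by
      have : ((-1 : ℤ)) ^ (a + 1) = (-1) ^ l * (-1) ^ c := by rw [hc, pow_add]
      have hc2 : ((-1 : ℤ)) ^ c * (-1) ^ c = 1 := by rw [← mul_pow]; simp
      rw [pow_succ] at this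
      linear_combination (-(-1 : ℤ) ^ c) * this - (-1) ^ l * hc2
    rw [e3]
    ring
  rw [h2]
  erw [h]
  simp

lemma eulerianCoeff_eq_zero {a N : ℕ} (h : a + 1 ≤ N) : eulerianCoeff a N = 0 := by
  rw [← sum_alternating_choose_mul_sub_pow a N, eulerianCoeff]
  symm
  apply Finset.sum_subset
  · exact Finset.range_mono (by omega)
  · intro l _ hl
    rw [Finset.mem_range] at hl
    rw [Nat.choose_eq_zero_of_lt (by omega)]
    simp

/-- In the vanishing full alternating sum, the terms with `l > N`, reflected by `l ↦ a + 1 - l`,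
make up `-eulerianCoeff a N'`. The condition `a ≠ 0` kills the leftover term `0 ^ a`. -/
lemma eulerianCoeff_symm {a N N' : ℕ} (ha : a ≠ 0) (h : N + N' = a + 1) :
    eulerianCoeff a N = eulerianCoeff a N' := by
  have h0 := sum_alternating_choose_mul_sub_pow a N
  rw [show a + 2 = N + 1 + N' by omega, Finset.sum_range_add] at h0
  have h1 : eulerianCoeff a N' = - ∑ x ∈ Finset.range N', (-1) ^ (N + 1 + x) *
      ((a + 1).choose (N + 1 + x) : ℤ) * ((N : ℤ) - ((N + 1 + x : ℕ) : ℤ)) ^ a := by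
    rw [← Finset.sum_range_reflect, eulerianCoeff, Finset.sum_range_succ, sub_self, zero_pow ha,
      mul_zero, add_zero, ← Finset.sum_neg_distrib]
    refine Finset.sum_congr rfl fun l hl => ?_
    rw [Finset.mem_range] at hl
    obtain ⟨c, rfl⟩ := Nat.exists_eq_add_of_lt hl
    have e1 : N + 1 + (l + c + 1 - 1 - l) = N + 1 + c := by omega
    rw [e1, ← Nat.choose_symm (show l ≤ a + 1 by omega), show a + 1 - l = N + 1 + c by omega]
    have e2 : ((l + c + 1 : ℕ) : ℤ) - l = (-1) * ((N : ℤ) - ((N + 1 + c : ℕ) : ℤ)) := by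
      push_cast; ring
    rw [e2, mul_pow]
    have e3 : (-1 : ℤ) ^ (a + 1) = (-1) ^ l * (-1) ^ (N + 1 + c) := by
      rw [← pow_add]; congr 1; omega
    have e4 : (-1 : ℤ) ^ l * (-1) ^ l = 1 := by rw [← mul_pow]; simp
    have e5 : (-1 : ℤ) ^ l * (-1) ^ a = - (-1) ^ (N + 1 + c) := by
      rw [pow_succ] at e3
      linear_combination (-(-1 : ℤ) ^ l) * e3 - (-1) ^ (N + 1 + c) * e4
    linear_combination (((a + 1).choose (N + 1 + c) : ℤ) *
      ((N : ℤ) - ((N + 1 + c : ℕ) : ℤ)) ^ a) * e5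
  rw [h1, eulerianCoeff]
  linarith

/-- The definition lists the coefficients from the top degree downwards; the symmetry of
`eulerianCoeff` lets them be read upwards, as the generating function requires. -/
lemma eulerianQuot_succ (i : ℕ) :
    eulerianQuot (i + 1) = ∑ p ∈ Finset.range (i + 1), C (eulerianCoeff (i + 1) (p + 1)) * X ^ p := by
  rw [eulerianQuot, ← Finset.sum_range_reflect]
  refine Finset.sum_congr rfl fun j hj => ?_
  rw [Finset.mem_range] at hj
  rw [← Finset.sum_mul, ← map_sum, show i + 1 - 1 - j = i - j by omega,
    show i - (i - j) = j by omega, ← eulerianCoeff_symm (N := i - j + 1) (by omega) (by omega),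
    eulerianCoeff]
  congr 2
  refine Finset.sum_congr rfl fun l _ => ?_
  push_cast
  ring

lemma natDegree_eulerianQuot_le (a : ℕ) : (eulerianQuot a).natDegree ≤ a - 1 := by
  cases a with
  | zero => simp [eulerianQuot]
  | succ i =>
    rw [eulerianQuot_succ]
    refine natDegree_sum_le_of_forall_le _ _ fun p hp => ?_
    rw [Finset.mem_range] at hp
    exact (natDegree_C_mul_X_pow_le _ _).trans (by omega)

lemma summable_norm_succ_pow_mul_geometric (a : ℕ) {z : ℂ} (hz : ‖z‖ < 1) :
    Summable fun b : ℕ => ‖((b : ℂ) + 1) ^ a * z ^ b‖ := by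
  by_cases h0 : z = 0
  · subst h0
    refine summable_of_ne_finset_zero (s := {0}) fun b hb => ?_
    rw [Finset.mem_singleton] at hb
    simp [hb]
  have h := (summable_nat_add_iff 1).2 (summable_norm_pow_mul_geometric_of_norm_lt_one a hz)
  have h' := h.mul_right ‖z‖⁻¹
  refine h'.congr fun b => ?_
  rw [norm_mul, norm_mul, norm_pow z (b + 1), pow_succ, norm_pow z b]
  have : ‖z‖ ≠ 0 := norm_ne_zero_iff.2 h0
  push_cast
  field_simp

lemma hasSum_eulerianQuot (a : ℕ) {z : ℂ} (hz : ‖z‖ < 1) :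
    HasSum (fun b : ℕ => ((b : ℂ) + 1) ^ a * z ^ b)
      (aeval z (eulerianQuot a) / (1 - z) ^ (a + 1)) := by
  have hz1 : 1 - z ≠ 0 := by
    intro h
    rw [sub_eq_zero] at h
    rw [← h] at hz
    simp at hz
  cases a with
  | zero => simpa [eulerianQuot] using hasSum_geometric_of_norm_lt_one hz
  | succ i =>
    -- `f` holds the terms of `(1 - z) ^ (i + 2)`. Its Cauchy product with the series `g` has
    -- coefficients `eulerianCoeff (i + 1) (N + 1)`, which vanish for `N > i`.
    set f : ℕ → ℂ := fun l => (-1) ^ l * ((i + 2).choose l : ℂ) * z ^ l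
    set g : ℕ → ℂ := fun b => ((b : ℂ) + 1) ^ (i + 1) * z ^ b
    have hf0 : ∀ l ∉ Finset.range (i + 3), f l = 0 := by
      intro l hl
      rw [Finset.mem_range] at hl
      simp [f, Nat.choose_eq_zero_of_lt (show i + 2 < l by omega)]
    have hfs : Summable fun l => ‖f l‖ :=
      summable_of_ne_finset_zero (s := Finset.range (i + 3)) fun l hl => by rw [hf0 l hl, norm_zero]
    have hgs : Summable fun b => ‖g b‖ := summable_norm_succ_pow_mul_geometric (i + 1) hz
    have hf : ∑' l, f l = (1 - z) ^ (i + 1 + 1) := by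
      rw [tsum_eq_sum hf0, sub_eq_neg_add, add_pow]
      refine Finset.sum_congr rfl fun l _ => ?_
      rw [neg_pow]
      simp only [f]
      ring
    have hmul := tsum_mul_tsum_eq_tsum_sum_range_of_summable_norm hfs hgs
    have hN : ∀ N : ℕ, ∑ l ∈ Finset.range (N + 1), f l * g (N - l) =
        (eulerianCoeff (i + 1) (N + 1) : ℂ) * z ^ N := by
      intro N
      rw [eulerianCoeff, Finset.sum_range_succ _ (N + 1), sub_self, zero_pow (Nat.succ_ne_zero i),
        mul_zero, add_zero, Int.cast_sum, Finset.sum_mul]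
      refine Finset.sum_congr rfl fun l hl => ?_
      rw [Finset.mem_range] at hl
      obtain ⟨c, hc⟩ := Nat.exists_eq_add_of_le (Nat.lt_succ_iff.1 hl)
      subst hc
      simp only [f, g, Nat.add_sub_cancel_left]
      push_cast
      ring
    simp only [hN] at hmul
    have hfin : ∑' N : ℕ, (eulerianCoeff (i + 1) (N + 1) : ℂ) * z ^ N =
        aeval z (eulerianQuot (i + 1)) := by
      rw [eulerianQuot_succ, map_sum, tsum_eq_sum (s := Finset.range (i + 1))]
      · refine Finset.sum_congr rfl fun p _ => ?_
        simp
      · intro N hN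
        rw [Finset.mem_range] at hN
        rw [eulerianCoeff_eq_zero (by omega)]
        simp
    rw [hf, hfin] at hmul
    have hg := hgs.of_norm.hasSum
    rwa [eq_div_of_mul_eq (pow_ne_zero _ hz1) ((mul_comm _ _).trans hmul)] at hg

/-! ### The analytic continuation of `Li_{k,-n}` -/

lemma norm_succ_pow_ge_one (a r : ℕ) : (1 : ℝ) ≤ ‖((a : ℂ) + 1) ^ r‖ := by
  rw [norm_pow]
  apply one_le_pow₀
  rw [← Nat.cast_succ, Complex.norm_natCast]
  simp

/-- The map `(a, b) ↦ (a + 1, a + b + 2)` onto the pairs `0 < m₁ < m₂`. -/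
def posLtPairEquiv : ℕ × ℕ ≃ {p : ℕ × ℕ // 0 < p.1 ∧ p.1 < p.2} where
  toFun p := ⟨(p.1 + 1, p.1 + p.2 + 2), by simp⟩
  invFun q := (q.1.1 - 1, q.1.2 - q.1.1 - 1)
  left_inv p := by
    ext <;> simp
    omega
  right_inv q := by
    obtain ⟨⟨x, y⟩, h1, h2⟩ := q
    simp only at h1 h2
    ext <;> simp <;> omega

/-- The closed form of `Li_{k,-n}` on the cut plane. -/
def doublePolylogClosed (k n : ℕ) (z : ℂ) : ℂ :=
  ∑ l ∈ Finset.range k,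
      z ^ 2 * (aeval z (polyP' k n l) / (1 - z) ^ (n - l + 1)) * polylogQuot (k - l) z +
    z ^ 2 * (aeval z (polyP' k n k) / (1 - z) ^ (n - k + 2))

lemma hasSum_succ_pow_div_succ_pow (k i : ℕ) {z : ℂ} (hz : ‖z‖ < 1) :
    HasSum (fun a : ℕ => ((a : ℂ) + 1) ^ i / ((a : ℂ) + 1) ^ k * z ^ a)
      (if i < k then polylogQuot (k - i) z
        else aeval z (eulerianQuot (i - k)) / (1 - z) ^ (i - k + 1)) ∧
    Summable fun a : ℕ => ‖((a : ℂ) + 1) ^ i / ((a : ℂ) + 1) ^ k * z ^ a‖ := by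
  have hne : ∀ a : ℕ, (a : ℂ) + 1 ≠ 0 := fun a => by exact_mod_cast Nat.succ_ne_zero a
  split_ifs with h
  · obtain ⟨c, rfl⟩ := Nat.exists_eq_add_of_lt h
    have e : ∀ a : ℕ, ((a : ℂ) + 1) ^ i / ((a : ℂ) + 1) ^ (i + c + 1) * z ^ a =
        z ^ a / ((a : ℂ) + 1) ^ (c + 1) := by
      intro a
      have := hne a
      rw [show i + c + 1 = i + (c + 1) by ring, pow_add]
      field_simp
    simp only [e, show i + c + 1 - i = c + 1 by omega]
    refine ⟨hasSum_polylogQuot _ hz, ?_⟩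
    refine Summable.of_nonneg_of_le (fun _ => norm_nonneg _) (fun a => ?_)
      (summable_geometric_of_lt_one (norm_nonneg z) hz)
    rw [norm_div, norm_pow z]
    exact div_le_self (by positivity) (norm_succ_pow_ge_one _ _)
  · obtain ⟨c, rfl⟩ := Nat.exists_eq_add_of_le (not_lt.1 h)
    have e : ∀ a : ℕ, ((a : ℂ) + 1) ^ (k + c) / ((a : ℂ) + 1) ^ k * z ^ a =
        ((a : ℂ) + 1) ^ c * z ^ a := by
      intro a
      have := hne a
      rw [pow_add]
      field_simp
    simp only [e, Nat.add_sub_cancel_left]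
    exact ⟨hasSum_eulerianQuot c hz, summable_norm_succ_pow_mul_geometric c hz⟩

/-- All terms with `i ≥ k` share the denominator `(1 - z) ^ (n - k + 2)`, because `(n - i + 1) + (i
- k + 1)` does not depend on `i`; hence they merge into one numerator. -/
lemma doublePolylogClosed_eq_sum {k n : ℕ} (hkn : k < n) {z : ℂ} (hz : 1 - z ≠ 0) :
    doublePolylogClosed k n z = ∑ i ∈ Finset.range (n + 1), (n.choose i : ℂ) * z ^ 2 *
      ((if i < k then polylogQuot (k - i) z
        else aeval z (eulerianQuot (i - k)) / (1 - z) ^ (i - k + 1)) *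
      (aeval z (eulerianQuot (n - i)) / (1 - z) ^ (n - i + 1))) := by
  rw [doublePolylogClosed, ← Finset.sum_range_add_sum_Ico _ (show k ≤ n + 1 by omega)]
  congr 1
  · refine Finset.sum_congr rfl fun l hl => ?_
    rw [Finset.mem_range] at hl
    rw [polyP', if_pos hl, if_pos hl, map_mul, aeval_C]
    simp only [algebraMap_int_eq, eq_intCast, Int.cast_natCast]
    ring
  · rw [polyP', if_neg (lt_irrefl k), map_sum, Finset.sum_div, Finset.mul_sum]
    refine Finset.sum_congr (by ext; simp) fun i hi => ?_
    rw [Finset.mem_Ico] at hi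
    rw [if_neg (by omega), map_mul, map_mul, aeval_C,
      show n - k + 2 = (n - i + 1) + (i - k + 1) by omega, pow_add]
    simp only [algebraMap_int_eq, eq_intCast, Int.cast_natCast]
    field_simp

lemma hasSum_mul_of_summable_norm {f g : ℕ → ℂ} {a b : ℂ} (hf : HasSum f a) (hg : HasSum g b)
    (hf' : Summable fun i => ‖f i‖) (hg' : Summable fun i => ‖g i‖) :
    HasSum (fun p : ℕ × ℕ => f p.1 * g p.2) (a * b) :=
  hf.mul hg (summable_mul_of_summable_norm hf' hg')

lemma hasSum_doublePolylogClosed {k n : ℕ} (hkn : k < n) {z : ℂ} (hz : ‖z‖ < 1) :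
    HasSum (fun p : {p : ℕ × ℕ // 0 < p.1 ∧ p.1 < p.2} =>
        z ^ p.1.2 / ((p.1.1 : ℂ) ^ (k : ℤ) * (p.1.2 : ℂ) ^ (-(n : ℤ))))
      (doublePolylogClosed k n z) := by
  rw [doublePolylogClosed_eq_sum hkn
    (one_sub_ne_zero_of_mem_cutPlane (mem_cutPlane_of_norm_lt_one hz)),
    ← posLtPairEquiv.hasSum_iff]
  have key : ∀ i ∈ Finset.range (n + 1), HasSum (fun p : ℕ × ℕ => (n.choose i : ℂ) * z ^ 2 *
      ((((p.1 : ℂ) + 1) ^ i / ((p.1 : ℂ) + 1) ^ k * z ^ p.1) *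
        (((p.2 : ℂ) + 1) ^ (n - i) * z ^ p.2))) ((n.choose i : ℂ) * z ^ 2 *
      ((if i < k then polylogQuot (k - i) z
        else aeval z (eulerianQuot (i - k)) / (1 - z) ^ (i - k + 1)) *
      (aeval z (eulerianQuot (n - i)) / (1 - z) ^ (n - i + 1)))) := by
    intro i _
    obtain ⟨h1, h2⟩ := hasSum_succ_pow_div_succ_pow k i hz
    exact (hasSum_mul_of_summable_norm h1 (hasSum_eulerianQuot (n - i) hz) h2
      (summable_norm_succ_pow_mul_geometric (n - i) hz)).mul_left _
  convert! hasSum_sum key using 1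
  ext ⟨a, b⟩
  have e : (((a + b + 2 : ℕ) : ℂ)) ^ n = ∑ i ∈ Finset.range (n + 1),
      ((a : ℂ) + 1) ^ i * ((b : ℂ) + 1) ^ (n - i) * (n.choose i : ℂ) := by
    rw [← add_pow]
    congr 1
    push_cast
    ring
  simp only [Function.comp, posLtPairEquiv, Equiv.coe_fn_mk, zpow_neg, zpow_natCast]
  rw [div_mul_eq_div_div, div_inv_eq_mul, e, Finset.mul_sum]
  refine Finset.sum_congr rfl fun i _ => ?_
  push_cast
  ring

lemma isDoublePolylogContinuation_doublePolylogClosed {k n : ℕ} (hkn : k < n) :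
    IsDoublePolylogContinuation (k : ℤ) (-(n : ℤ)) (doublePolylogClosed k n) := by
  refine ⟨?_, fun z hz => (hasSum_doublePolylogClosed hkn hz).tsum_eq.symm⟩
  apply DifferentiableOn.analyticOnNhd _ isOpen_cutPlane
  have hpoly : ∀ (p : ℤ[X]) (e : ℕ), DifferentiableOn ℂ
      (fun z : ℂ => z ^ 2 * (aeval z p / (1 - z) ^ e)) cutPlane := by
    intro p e z hz
    have h := pow_ne_zero e (one_sub_ne_zero_of_mem_cutPlane hz)
    have hp : DifferentiableAt ℂ (fun z : ℂ => aeval z p) z := p.differentiableAt_aeval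
    apply DifferentiableAt.differentiableWithinAt
    fun_prop (disch := assumption)
  unfold doublePolylogClosed
  refine DifferentiableOn.add (DifferentiableOn.fun_sum fun l _ => ?_) (hpoly _ _)
  exact (hpoly _ _).mul (differentiableOn_polylogQuot _)

/-- `Classical.epsilon` is meaningful only once a continuation is known to exist; the closed form is
the witness. -/
lemma isDoublePolylogContinuation_doublePolylog {k n : ℕ} (hkn : k < n) :
    IsDoublePolylogContinuation (k : ℤ) (-(n : ℤ)) (doublePolylog (k : ℤ) (-(n : ℤ))) :=
  Classical.epsilon_spec ⟨_, isDoublePolylogContinuation_doublePolylogClosed hkn⟩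

lemma doublePolylog_eq_closed {k n : ℕ} (hkn : k < n) {z : ℂ} (hz : z ∈ cutPlane) :
    doublePolylog (k : ℤ) (-(n : ℤ)) z = doublePolylogClosed k n z := by
  have h1 := isDoublePolylogContinuation_doublePolylog hkn
  have h2 := isDoublePolylogContinuation_doublePolylogClosed hkn
  refine h1.1.eqOn_of_preconnected_of_eventuallyEq h2.1 isPreconnected_cutPlane
    zero_mem_cutPlane ?_ hz
  filter_upwards [Metric.ball_mem_nhds (0 : ℂ) one_pos] with w hw
  rw [mem_ball_zero_iff] at hw
  rw [h1.2 w hw, h2.2 w hw]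

/-! ### The coefficients `A'` -/

/-- This bound ensures that the indices `j < n - l` exhaust the expansion in powers of `1 - z`. -/
lemma natDegree_polyP'_lt {k n l : ℕ} (hkn : k < n) (hl : l ≤ k) :
    (polyP' k n l).natDegree < n - l := by
  unfold polyP'
  split_ifs with h
  · have := natDegree_C_mul_le (n.choose l : ℤ) (eulerianQuot (n - l))
    have := natDegree_eulerianQuot_le (n - l)
    omega
  · obtain rfl : l = k := by omega
    -- In the truncated bounds `n - i - 1` and `i - l - 1` at most one truncation occurs, since `l <
    -- n`, so their sum never exceeds `n - l - 1`.
    refine lt_of_le_of_lt (natDegree_sum_le_of_forall_le (n := n - l - 1) _ _ fun i hi => ?_)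
      (by omega)
    rw [Finset.mem_Icc] at hi
    refine natDegree_mul_le.trans ?_
    have := natDegree_C_mul_le (n.choose i : ℤ) (eulerianQuot (n - i))
    have := natDegree_eulerianQuot_le (n - i)
    have := natDegree_eulerianQuot_le (i - l)
    omega

lemma aeval_polyP'_one_sub {k n l : ℕ} (hkn : k < n) (hl : l ≤ k) (w : ℂ) :
    aeval (1 - w) (polyP' k n l) = ∑ j ∈ Finset.range (n - l), (coeffA' k n l j : ℂ) * w ^ j := by
  have h1 : aeval (1 - w) (polyP' k n l) = aeval w ((polyP' k n l).comp (1 - X)) := by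
    rw [aeval_comp]
    simp
  have h2 : ((polyP' k n l).comp (1 - X)).natDegree < n - l := by
    refine lt_of_le_of_lt natDegree_comp_le ?_
    have h3 : (1 - X : ℤ[X]).natDegree ≤ 1 := by
      refine (natDegree_sub_le _ _).trans ?_
      simp
    exact lt_of_le_of_lt (Nat.mul_le_mul_left _ h3) (by simpa using natDegree_polyP'_lt hkn hl)
  rw [h1, aeval_eq_sum_range' h2]
  refine Finset.sum_congr rfl fun j _ => ?_
  rw [zsmul_eq_mul, coeffA']

/-! ### Multiple Hurwitz zeta star values in `[0, ∞]` -/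

lemma sum_antidiagonalTuple_succ {M : Type*} [AddCommMonoid M] (d m : ℕ)
    (f : (Fin (d + 1) → ℕ) → M) :
    ∑ a ∈ Finset.Nat.antidiagonalTuple (d + 1) m, f a =
      ∑ p ∈ Finset.HasAntidiagonal.antidiagonal m, ∑ b ∈ Finset.Nat.antidiagonalTuple d p.2,
        f (Fin.cons p.1 b) := by
  rw [Finset.sum_sigma']
  refine Finset.sum_bij' (fun a _ => ⟨(a 0, ∑ i, Fin.tail a i), Fin.tail a⟩)
    (fun x _ => Fin.cons x.1.1 x.2) ?_ ?_ ?_ ?_ ?_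
  · intro a ha
    rw [Finset.Nat.mem_antidiagonalTuple, Fin.sum_univ_succ] at ha
    simpa [Finset.Nat.mem_antidiagonalTuple, Fin.tail] using ha
  · rintro ⟨⟨x, y⟩, b⟩ h
    simp only [Finset.mem_sigma, Finset.HasAntidiagonal.mem_antidiagonal, Finset.Nat.mem_antidiagonalTuple] at h
    simp [Finset.Nat.mem_antidiagonalTuple, Fin.sum_univ_succ, h.2, h.1]
  · intro a _
    simp
  · rintro ⟨⟨x, y⟩, b⟩ h
    simp only [Finset.mem_sigma, Finset.HasAntidiagonal.mem_antidiagonal, Finset.Nat.mem_antidiagonalTuple] at h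
    simp [h.2]
  · intro a _
    simp

/-- A monotone tuple of length `d + 1` is its head together with the increments over it. -/
def monotoneConsEquiv (d : ℕ) :
    ℕ × {m : Fin d → ℕ // Monotone m} ≃ {m : Fin (d + 1) → ℕ // Monotone m} where
  toFun x := ⟨Fin.cons x.1 fun i => x.1 + x.2.1 i, by
    intro i j hij
    induction i using Fin.cases with
    | zero =>
      induction j using Fin.cases with
      | zero => rfl
      | succ j => simp
    | succ i =>
      induction j using Fin.cases with
      | zero => simp at hij
      | succ j => simpa using x.2.2 (Fin.succ_le_succ_iff.1 hij)⟩
  invFun m := (m.1 0, ⟨fun i => m.1 i.succ - m.1 0, fun i j hij =>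
    Nat.sub_le_sub_right (m.2 (Fin.succ_le_succ_iff.2 hij)) _⟩)
  left_inv x := by simp
  right_inv m := by
    ext i
    induction i using Fin.cases with
    | zero => rfl
    | succ i =>
      simp only [Fin.cons_succ]
      exact Nat.add_sub_of_le (m.2 (Fin.zero_le _))

/-- The multiple Hurwitz zeta star value with constant parameter `s`, summed in `[0, ∞]`. -/
def hurwitzZetaStarENN {d : ℕ} (p : Fin d → ℕ) (s : ℝ) : ENNReal :=
  ∑' m : {m : Fin d → ℕ // Monotone m}, ENNReal.ofReal (∏ i, 1 / ((m.1 i : ℝ) + s) ^ p i)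

/-- No convergence is needed: for a divergent sum both sides take the default value `0`. -/
lemma toReal_hurwitzZetaStarENN {d : ℕ} (p : Fin d → ℕ) {s : ℝ} (hs : 0 < s) :
    (hurwitzZetaStarENN p s).toReal = hurwitzZetaStar p fun _ => s := by
  rw [hurwitzZetaStarENN, ENNReal.tsum_toReal_eq fun _ => ENNReal.ofReal_ne_top]
  refine tsum_congr fun m => ENNReal.toReal_ofReal ?_
  exact Finset.prod_nonneg fun i _ => by positivity

lemma hurwitzZetaStarENN_zero (p : Fin 0 → ℕ) (s : ℝ) : hurwitzZetaStarENN p s = 1 := by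
  have : Unique {m : Fin 0 → ℕ // Monotone m} :=
    ⟨⟨⟨Fin.elim0, fun i => i.elim0⟩⟩, fun _ => Subtype.ext (Subsingleton.elim _ _)⟩
  rw [hurwitzZetaStarENN, tsum_eq_single default fun b hb => (hb (Subsingleton.elim _ _)).elim]
  simp

/-- Fix the smallest index `q` and subtract it from the others: what remains is a star sum of depth
`d` with parameter `s + q`. -/
lemma hurwitzZetaStarENN_succ {d : ℕ} (p : Fin (d + 1) → ℕ) {s : ℝ} (hs : 0 < s) :
    hurwitzZetaStarENN p s = ∑' q : ℕ, ENNReal.ofReal (1 / (s + q) ^ p 0) *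
      hurwitzZetaStarENN (Fin.tail p) (s + q) := by
  rw [hurwitzZetaStarENN, ← (monotoneConsEquiv d).tsum_eq, ENNReal.tsum_prod']
  refine tsum_congr fun q => ?_
  rw [hurwitzZetaStarENN, ← ENNReal.tsum_mul_left]
  refine tsum_congr fun m => ?_
  rw [← ENNReal.ofReal_mul (by positivity), Fin.prod_univ_succ]
  congr 2
  · simp [monotoneConsEquiv, add_comm]
  · refine Finset.prod_congr rfl fun i _ => ?_
    simp only [monotoneConsEquiv, Equiv.coe_fn_mk, Fin.cons_succ, Fin.tail]
    push_cast
    congr 2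
    ring

/-- The exponents `(a₁ + 1, …, a_{d-1} + 1, a_d + 2)`. -/
def starExponent {d : ℕ} (a : Fin d → ℕ) : Fin d → ℕ :=
  fun i => if (i : ℕ) + 1 = d then a i + 2 else a i + 1

lemma tail_starExponent {d : ℕ} (a : Fin (d + 1) → ℕ) :
    Fin.tail (starExponent a) = starExponent (Fin.tail a) := by
  ext i
  simp [Fin.tail, starExponent]

/-- Abstract unrolling of the recursion, to be applied to `negPolylogIntegral`. The sum over `q`
supplies the smallest index, so `I d` yields depth `d + 1`. -/
lemma tsum_eq_sum_hurwitzZetaStarENN {I : ℕ → ℕ → ℝ → ENNReal}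
    (h0 : ∀ (m : ℕ) (s : ℝ), 0 < s → I 0 m s = ENNReal.ofReal ((m + 1) / s ^ (m + 2)))
    (h1 : ∀ (d m : ℕ) (s : ℝ), 0 < s → I (d + 1) m s = ∑ p ∈ Finset.HasAntidiagonal.antidiagonal m,
      ENNReal.ofReal (1 / s ^ (p.1 + 1)) * ∑' q : ℕ, I d p.2 (s + q))
    (d m : ℕ) {s : ℝ} (hs : 0 < s) :
    ∑' q : ℕ, I d m (s + q) = ∑ a ∈ Finset.Nat.antidiagonalTuple (d + 1) m,
      ENNReal.ofReal ((a (Fin.last d) : ℝ) + 1) * hurwitzZetaStarENN (starExponent a) s := by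
  induction d generalizing m s with
  | zero =>
    rw [Finset.Nat.antidiagonalTuple_one, Finset.sum_singleton, hurwitzZetaStarENN_succ _ hs,
      ← ENNReal.tsum_mul_left]
    refine tsum_congr fun q => ?_
    rw [h0 _ _ (by positivity), hurwitzZetaStarENN_zero, mul_one,
      ← ENNReal.ofReal_mul (by positivity)]
    congr 1
    simp [starExponent, div_eq_mul_inv]
  | succ d ih =>
    have e : ∀ q : ℕ, I (d + 1) m (s + q) = ∑ a ∈ Finset.Nat.antidiagonalTuple (d + 1 + 1) m,
        ENNReal.ofReal ((a (Fin.last (d + 1)) : ℝ) + 1) *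
          (ENNReal.ofReal (1 / (s + q) ^ (starExponent a 0)) *
            hurwitzZetaStarENN (Fin.tail (starExponent a)) (s + q)) := by
      intro q
      rw [h1 _ _ _ (by positivity), sum_antidiagonalTuple_succ]
      refine Finset.sum_congr rfl fun p _ => ?_
      rw [ih _ (by positivity), Finset.mul_sum]
      refine Finset.sum_congr rfl fun b _ => ?_
      rw [tail_starExponent, Fin.tail_cons, ← Fin.succ_last, Fin.cons_succ, mul_left_comm]
      simp [starExponent]
    simp only [e]
    rw [Summable.tsum_finsetSum fun _ _ => ENNReal.summable]
    refine Finset.sum_congr rfl fun a _ => ?_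
    rw [ENNReal.tsum_mul_left, ← hurwitzZetaStarENN_succ _ hs]

/-- The outermost recursion step carries no sum over shifts of `s`, so its factor `1 / s ^ (a 0 +
1)` stays outside the star value. -/
lemma eq_sum_hurwitzZetaStarENN {I : ℕ → ℕ → ℝ → ENNReal}
    (h0 : ∀ (m : ℕ) (s : ℝ), 0 < s → I 0 m s = ENNReal.ofReal ((m + 1) / s ^ (m + 2)))
    (h1 : ∀ (d m : ℕ) (s : ℝ), 0 < s → I (d + 1) m s = ∑ p ∈ Finset.HasAntidiagonal.antidiagonal m,
      ENNReal.ofReal (1 / s ^ (p.1 + 1)) * ∑' q : ℕ, I d p.2 (s + q))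
    (d m : ℕ) {s : ℝ} (hs : 0 < s) :
    I (d + 1) m s = ∑ a ∈ Finset.Nat.antidiagonalTuple (d + 1 + 1) m,
      ENNReal.ofReal (((a (Fin.last (d + 1)) : ℝ) + 1) * (1 / s ^ (a 0 + 1))) *
        hurwitzZetaStarENN (starExponent fun i => a i.succ) s := by
  rw [h1 _ _ _ hs, sum_antidiagonalTuple_succ]
  refine Finset.sum_congr rfl fun p _ => ?_
  rw [tsum_eq_sum_hurwitzZetaStarENN h0 h1 _ _ hs, Finset.mul_sum]
  refine Finset.sum_congr rfl fun b _ => ?_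
  rw [← Fin.succ_last, Fin.cons_succ, Fin.cons_zero, ENNReal.ofReal_mul (by positivity)]
  simp only [Fin.cons_succ]
  ring

/-! ### Incomplete Gamma integrals -/

/-- Minus the primitive of `t ^ m / m! * exp (-s t)` which vanishes at infinity. -/
def gammaTail (m : ℕ) (s t : ℝ) : ℝ :=
  ∑ p ∈ Finset.HasAntidiagonal.antidiagonal m,
    1 / s ^ (p.1 + 1) * (t ^ p.2 / (p.2.factorial : ℝ) * Real.exp (-(s * t)))

lemma gammaTail_succ (m : ℕ) {s : ℝ} (hs : 0 < s) (t : ℝ) :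
    gammaTail (m + 1) s t =
      (t ^ (m + 1) / ((m + 1).factorial : ℝ) * Real.exp (-(s * t)) + gammaTail m s t) / s := by
  rw [gammaTail, Finset.Nat.sum_antidiagonal_succ, gammaTail, add_div, Finset.sum_div]
  congr 1
  · simp only [zero_add, pow_one]
    ring
  · refine Finset.sum_congr rfl fun p _ => ?_
    rw [pow_succ _ (p.1 + 1)]
    field_simp

lemma hasDerivAt_pow_div_factorial_mul_exp (m : ℕ) (s t : ℝ) :
    HasDerivAt (fun t : ℝ => t ^ (m + 1) / ((m + 1).factorial : ℝ) * Real.exp (-(s * t)))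
      (t ^ m / (m.factorial : ℝ) * Real.exp (-(s * t)) -
        s * (t ^ (m + 1) / ((m + 1).factorial : ℝ) * Real.exp (-(s * t)))) t := by
  have h1 : HasDerivAt (fun t : ℝ => Real.exp (-(s * t))) (Real.exp (-(s * t)) * (-(s * 1))) t :=
    (((hasDerivAt_id t).const_mul s).neg).exp
  have h2 := ((hasDerivAt_pow (m + 1) t).div_const ((m + 1).factorial : ℝ)).mul h1
  refine h2.congr_deriv ?_
  rw [Nat.factorial_succ]
  push_cast
  have : (m.factorial : ℝ) ≠ 0 := by positivity
  have : (m : ℝ) + 1 ≠ 0 := by positivity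
  field_simp
  ring

/-- In the induction the product rule leaves `t ^ m / m! * exp (-s t)`, which cancels against the
derivative of `gammaTail m s`. -/
lemma hasDerivAt_gammaTail (m : ℕ) {s : ℝ} (hs : 0 < s) (t : ℝ) :
    HasDerivAt (gammaTail m s) (-(t ^ m / (m.factorial : ℝ) * Real.exp (-(s * t)))) t := by
  induction m with
  | zero =>
    have h1 : HasDerivAt (fun t : ℝ => 1 / s * Real.exp (-(s * t)))
        (1 / s * (Real.exp (-(s * t)) * (-(s * 1)))) t :=
      ((((hasDerivAt_id t).const_mul s).neg).exp).const_mul _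
    have e : gammaTail 0 s = fun t : ℝ => 1 / s * Real.exp (-(s * t)) := by
      ext t
      simp [gammaTail]
    rw [e]
    refine h1.congr_deriv ?_
    simp
    field_simp
  | succ m ih =>
    have e : gammaTail (m + 1) s = fun t : ℝ =>
        (t ^ (m + 1) / ((m + 1).factorial : ℝ) * Real.exp (-(s * t)) + gammaTail m s t) / s :=
      funext fun t => gammaTail_succ m hs t
    rw [e]
    refine (((hasDerivAt_pow_div_factorial_mul_exp m s t).add ih).div_const s).congr_deriv ?_
    field_simp
    ring

lemma tendsto_gammaTail (m : ℕ) {s : ℝ} (hs : 0 < s) :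
    Filter.Tendsto (gammaTail m s) Filter.atTop (nhds 0) := by
  have h : ∀ j : ℕ, Filter.Tendsto (fun t : ℝ => t ^ j / (j.factorial : ℝ) * Real.exp (-(s * t)))
      Filter.atTop (nhds 0) := by
    intro j
    have h1 := (Real.tendsto_pow_mul_exp_neg_atTop_nhds_zero j).comp
      (Filter.tendsto_id.const_mul_atTop hs)
    have h2 := h1.const_mul (1 / (s ^ j * (j.factorial : ℝ)))
    rw [mul_zero] at h2
    refine h2.congr fun t => ?_
    simp only [Function.comp, id, mul_pow]
    field_simp
  have h2 := tendsto_finsetSum (Finset.HasAntidiagonal.antidiagonal m) fun p _ =>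
    (h p.2).const_mul (1 / s ^ (p.1 + 1))
  show Filter.Tendsto (fun t => gammaTail m s t) Filter.atTop (nhds 0)
  simpa [gammaTail] using h2

lemma integrableOn_pow_mul_exp (m : ℕ) {s : ℝ} (hs : 0 < s) {u : ℝ} (hu : 0 ≤ u) :
    IntegrableOn (fun t : ℝ => t ^ m / (m.factorial : ℝ) * Real.exp (-(s * t))) (Ioi u) := by
  have h := integrableOn_Ioi_deriv_of_nonpos' (a := u) (g := gammaTail m s) (l := 0)
    (fun t _ => hasDerivAt_gammaTail m hs t)
    (fun t ht => by
      have : 0 < t := hu.trans_lt ht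
      exact neg_nonpos.2 (by positivity)) (tendsto_gammaTail m hs)
  simpa using h.neg

lemma integral_pow_mul_exp (m : ℕ) {s : ℝ} (hs : 0 < s) {u : ℝ} (hu : 0 ≤ u) :
    ∫ t in Ioi u, t ^ m / (m.factorial : ℝ) * Real.exp (-(s * t)) = gammaTail m s u := by
  have h := integral_Ioi_of_hasDerivAt_of_tendsto' (a := u) (f := gammaTail m s) (m := 0)
    (fun t _ => hasDerivAt_gammaTail m hs t) (integrableOn_pow_mul_exp m hs hu).neg
    (tendsto_gammaTail m hs)
  rw [integral_neg] at h
  linarith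

lemma gammaTail_zero_right (m : ℕ) (s : ℝ) : gammaTail m s 0 = 1 / s ^ (m + 1) := by
  rw [gammaTail, Finset.sum_eq_single (m, 0)]
  · simp
  · rintro ⟨x, y⟩ h1 h2
    rw [Finset.HasAntidiagonal.mem_antidiagonal] at h1
    have : y ≠ 0 := by
      rintro rfl
      simp at h1
      simp [h1] at h2
    simp [zero_pow this]
  · simp

lemma lintegral_pow_mul_exp (m : ℕ) {s : ℝ} (hs : 0 < s) {u : ℝ} (hu : 0 ≤ u) :
    ∫⁻ t in Ioi u, ENNReal.ofReal (t ^ m / (m.factorial : ℝ) * Real.exp (-(s * t))) =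
      ENNReal.ofReal (gammaTail m s u) := by
  rw [← integral_pow_mul_exp m hs hu, ofReal_integral_eq_lintegral_ofReal
    (integrableOn_pow_mul_exp m hs hu)]
  refine (ae_restrict_iff' measurableSet_Ioi).2 (Filter.Eventually.of_forall fun t ht => ?_)
  have : 0 < t := hu.trans_lt ht
  simp only [Pi.zero_apply]
  positivity

/-! ### The functions `-Li_{r+1}(1 - exp t)` -/

/-- `exp t * Li_r(1 - exp t) / (1 - exp t)` for `t ≥ 0`, extended by a constant to `t < 0`. -/
def polylogKernel (r : ℕ) (t : ℝ) : ℝ :=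
  Real.exp (max t 0) * polylogQuotReal r (1 - Real.exp (max t 0))

/-- `-Li_{r+1}(1 - exp t)` for `t ≥ 0`. -/
def negPolylog (r : ℕ) (t : ℝ) : ℝ := ∫ u in (0 : ℝ)..t, polylogKernel r u

lemma one_sub_exp_nonpos {t : ℝ} (ht : 0 ≤ t) : 1 - Real.exp t ≤ 0 := by
  have := Real.one_le_exp ht
  linarith

lemma continuous_polylogKernel (r : ℕ) : Continuous (polylogKernel r) := by
  have hc : Continuous fun t : ℝ => Real.exp (max t 0) := by fun_prop
  refine hc.mul ?_
  exact (continuousOn_polylogQuotReal r).comp_continuous (continuous_const.sub hc)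
    fun t => one_sub_exp_nonpos (le_max_right _ _)

lemma polylogKernel_nonneg (r : ℕ) (t : ℝ) : 0 ≤ polylogKernel r t :=
  mul_nonneg (Real.exp_pos _).le
    (polylogQuotReal_nonneg r (one_sub_exp_nonpos (le_max_right _ _)))

lemma continuous_negPolylog (r : ℕ) : Continuous (negPolylog r) :=
  intervalIntegral.continuous_primitive
    (fun _ _ => (continuous_polylogKernel r).intervalIntegrable _ _) 0

lemma negPolylog_nonneg (r : ℕ) {t : ℝ} (ht : 0 ≤ t) : 0 ≤ negPolylog r t :=
  intervalIntegral.integral_nonneg ht fun u _ => polylogKernel_nonneg r u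

/-- Substitute `v = 1 - exp u` in `z * polylogQuotReal (r + 1) z = ∫₀^z polylogQuotReal r`. -/
lemma negPolylog_eq (r : ℕ) {t : ℝ} (ht : 0 ≤ t) :
    negPolylog r t = (Real.exp t - 1) * polylogQuotReal (r + 1) (1 - Real.exp t) := by
  have h1 : (1 - Real.exp t) * polylogQuotReal (r + 1) (1 - Real.exp t) =
      ∫ v in (0 : ℝ)..(1 - Real.exp t), polylogQuotReal r v := by
    simp only [polylogQuotReal]
    rw [intervalIntegral.mul_integral_comp_mul_right]
    simp
  have h2 := intervalIntegral.integral_comp_mul_deriv'' (a := 0) (b := t)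
    (f := fun u => 1 - Real.exp u) (f' := fun u => -Real.exp u) (g := polylogQuotReal r)
    (by fun_prop) (fun u _ => ((Real.hasDerivAt_exp u).const_sub 1).hasDerivWithinAt)
    (by fun_prop)
    ((continuousOn_polylogQuotReal r).mono (by
      rintro _ ⟨u, hu, rfl⟩
      rw [uIcc_of_le ht] at hu
      exact one_sub_exp_nonpos hu.1))
  simp only [Real.exp_zero, sub_self, ← h1] at h2
  have h3 : negPolylog r t =
      -∫ u in (0 : ℝ)..t, (polylogQuotReal r ∘ fun u => 1 - Real.exp u) u * -Real.exp u := by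
    rw [negPolylog, ← intervalIntegral.integral_neg]
    refine intervalIntegral.integral_congr fun u hu => ?_
    rw [uIcc_of_le ht] at hu
    simp only [polylogKernel, max_eq_left hu.1, Function.comp]
    ring
  rw [h3, h2]
  ring

lemma polylogKernel_zero (t : ℝ) : polylogKernel 0 t = 1 := by
  simp [polylogKernel, polylogQuotReal, Real.exp_ne_zero]

lemma negPolylog_zero (t : ℝ) : negPolylog 0 t = t := by
  simp [negPolylog, polylogKernel_zero]

lemma one_sub_exp_neg_pos {t : ℝ} (ht : 0 < t) : 0 < 1 - Real.exp (-t) := by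
  have : Real.exp (-t) < 1 := Real.exp_lt_one_iff.2 (by linarith)
  linarith

/-- This is the differential relation between consecutive polylogarithms; the geometric series of
the factor `(1 - exp (-t))⁻¹` later creates the summation index of `ζ⋆`. -/
lemma polylogKernel_succ (r : ℕ) {t : ℝ} (ht : 0 < t) :
    polylogKernel (r + 1) t = negPolylog r t * (1 - Real.exp (-t))⁻¹ := by
  rw [negPolylog_eq r ht.le, polylogKernel, max_eq_left ht.le, Real.exp_neg]
  have h1 : 0 < Real.exp t - 1 := by
    have := Real.one_lt_exp_iff.2 ht
    linarith
  have h2 := Real.exp_pos t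
  have h3 : 1 - (Real.exp t)⁻¹ = (Real.exp t - 1) / Real.exp t := by field_simp
  rw [h3]
  field_simp

lemma polylogKernel_le (r : ℕ) {t : ℝ} (ht : 0 < t) : polylogKernel r t ≤ (1 + t) ^ r := by
  induction r generalizing t with
  | zero => simp [polylogKernel_zero]
  | succ r ih =>
    have h1 : negPolylog r t ≤ t * (1 + t) ^ r := by
      have h := intervalIntegral.integral_mono_on_of_le_Ioo (μ := volume) ht.le
        (f := polylogKernel r) (g := fun _ => (1 + t) ^ r)
        ((continuous_polylogKernel r).intervalIntegrable _ _) (by simp)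
        (fun u hu => (ih hu.1).trans
          (pow_le_pow_left₀ (by linarith [hu.1]) (by linarith [hu.2]) r))
      simpa [negPolylog] using h
    have h2 := one_sub_exp_neg_pos ht
    -- Equivalent to `(1 + t) * exp (-t) ≤ 1`; it lets each division by `1 - exp (-t)` cost only a
    -- factor `(1 + t) / t`.
    have h3 : t ≤ (1 + t) * (1 - Real.exp (-t)) := by
      have h4 := Real.add_one_le_exp t
      have h5 : Real.exp (-t) * Real.exp t = 1 := by rw [← Real.exp_add]; simp
      nlinarith [Real.exp_pos (-t)]
    rw [polylogKernel_succ r ht, ← div_eq_mul_inv, div_le_iff₀ h2, pow_succ]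
    calc negPolylog r t ≤ t * (1 + t) ^ r := h1
      _ ≤ ((1 + t) * (1 - Real.exp (-t))) * (1 + t) ^ r := by gcongr
      _ = _ := by ring

lemma negPolylog_le (r : ℕ) {t : ℝ} (ht : 0 < t) : negPolylog r t ≤ (1 + t) ^ (r + 1) := by
  have h1 := polylogKernel_le (r + 1) ht
  rw [polylogKernel_succ r ht] at h1
  refine le_trans ?_ h1
  refine le_mul_of_one_le_right (negPolylog_nonneg r ht.le) ?_
  rw [one_le_inv₀ (one_sub_exp_neg_pos ht)]
  linarith [Real.exp_pos (-t)]

/-! ### The integrals of `t ^ m / m! * exp (-s t) * (-Li_{d+1}(1 - exp t))` -/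

/-- `∫₀^∞ t ^ m / m! * exp (-s t) * (-Li_{d+1}(1 - exp t)) dt`, as an element of `[0, ∞]`. -/
def negPolylogIntegral (d m : ℕ) (s : ℝ) : ENNReal :=
  ∫⁻ t in Ioi (0 : ℝ),
    ENNReal.ofReal (t ^ m / (m.factorial : ℝ) * Real.exp (-(s * t)) * negPolylog d t)

lemma negPolylogIntegral_zero (m : ℕ) {s : ℝ} (hs : 0 < s) :
    negPolylogIntegral 0 m s = ENNReal.ofReal ((m + 1) / s ^ (m + 2)) := by
  have e : ∀ t : ℝ, ENNReal.ofReal (t ^ m / (m.factorial : ℝ) * Real.exp (-(s * t)) *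
      negPolylog 0 t) = ENNReal.ofReal (m + 1) * ENNReal.ofReal
        (t ^ (m + 1) / ((m + 1).factorial : ℝ) * Real.exp (-(s * t))) := by
    intro t
    rw [← ENNReal.ofReal_mul (by positivity), negPolylog_zero, Nat.factorial_succ]
    push_cast
    congr 1
    field_simp
    ring
  rw [negPolylogIntegral]
  simp only [e]
  rw [lintegral_const_mul _ (by fun_prop), lintegral_pow_mul_exp _ hs le_rfl,
    gammaTail_zero_right, ← ENNReal.ofReal_mul (by positivity)]
  congr 1
  ring

lemma ofReal_negPolylog (d : ℕ) {t : ℝ} (ht : 0 ≤ t) :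
    ENNReal.ofReal (negPolylog d t) =
      ∫⁻ u in Ioi (0 : ℝ), (Iio t).indicator (fun u => ENNReal.ofReal (polylogKernel d u)) u := by
  rw [negPolylog, intervalIntegral.integral_of_le ht, integral_Ioc_eq_integral_Ioo,
    ofReal_integral_eq_lintegral_ofReal, setLIntegral_indicator measurableSet_Iio, inter_comm,
    Ioi_inter_Iio]
  · exact ((continuous_polylogKernel d).integrableOn_Icc).mono_set Ioo_subset_Icc_self
  · exact Filter.Eventually.of_forall fun u => polylogKernel_nonneg d u

/-- Tonelli on the triangle `0 < u < t`: the inner integral over `t > u` is the incomplete Gamma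
integral. The indicator in `f` keeps both iterated integrals over `Ioi 0`. -/
lemma negPolylogIntegral_eq_lintegral_gammaTail (d m : ℕ) {s : ℝ} (hs : 0 < s) :
    negPolylogIntegral d m s = ∫⁻ u in Ioi (0 : ℝ),
      ENNReal.ofReal (polylogKernel d u) * ENNReal.ofReal (gammaTail m s u) := by
  have hM : Measurable (polylogKernel d) := (continuous_polylogKernel d).measurable
  set φ : ℝ → ENNReal := fun t =>
    ENNReal.ofReal (t ^ m / (m.factorial : ℝ) * Real.exp (-(s * t))) with hφ
  have hφm : Measurable φ := by fun_prop
  set f : ℝ → ℝ → ENNReal := fun t u =>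
    {p : ℝ × ℝ | p.2 < p.1}.indicator
      (fun p => φ p.1 * ENNReal.ofReal (polylogKernel d p.2)) (t, u) with hf
  have hfm : Measurable (Function.uncurry f) := by
    have : Measurable fun p : ℝ × ℝ => φ p.1 * ENNReal.ofReal (polylogKernel d p.2) := by
      fun_prop
    exact this.indicator (measurableSet_lt measurable_snd measurable_fst)
  have h1 : negPolylogIntegral d m s =
      ∫⁻ t in Ioi (0 : ℝ), ∫⁻ u in Ioi (0 : ℝ), f t u := by
    rw [negPolylogIntegral]
    refine setLIntegral_congr_fun measurableSet_Ioi fun t ht => ?_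
    have ht0 : (0 : ℝ) < t := ht
    rw [ENNReal.ofReal_mul (by positivity), ofReal_negPolylog d ht0.le,
      ← lintegral_const_mul _ ((by fun_prop : Measurable fun u =>
        ENNReal.ofReal (polylogKernel d u)).indicator measurableSet_Iio)]
    refine lintegral_congr fun u => ?_
    by_cases h : u < t <;> simp [hf, hφ, indicator, h]
  rw [h1, lintegral_lintegral_swap hfm.aemeasurable]
  refine setLIntegral_congr_fun measurableSet_Ioi fun u hu => ?_
  have hu0 : (0 : ℝ) < u := hu
  rw [← lintegral_pow_mul_exp m hs hu0.le, ← lintegral_const_mul _ (by fun_prop)]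
  have h2 : ∀ t, f t u = (Ioi u).indicator
      (fun t => ENNReal.ofReal (polylogKernel d u) * φ t) t := by
    intro t
    by_cases h : u < t <;> simp [hf, indicator, h, mul_comm]
  simp only [h2]
  rw [setLIntegral_indicator measurableSet_Ioi, Ioi_inter_Ioi, sup_eq_left.2 hu0.le]

lemma ofReal_inv_one_sub_exp_neg {t : ℝ} (ht : 0 < t) :
    ENNReal.ofReal (1 - Real.exp (-t))⁻¹ =
      ∑' q : ℕ, ENNReal.ofReal (Real.exp (-((q : ℝ) * t))) := by
  have h1 : Real.exp (-t) < 1 := by linarith [one_sub_exp_neg_pos ht]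
  have h2 := hasSum_geometric_of_lt_one (Real.exp_pos (-t)).le h1
  rw [← h2.tsum_eq, ENNReal.ofReal_tsum_of_nonneg (fun q => by positivity) h2.summable]
  refine tsum_congr fun q => ?_
  rw [← Real.exp_nat_mul]
  congr 2
  ring

lemma negPolylogIntegral_succ (d m : ℕ) {s : ℝ} (hs : 0 < s) :
    negPolylogIntegral (d + 1) m s = ∑ p ∈ Finset.HasAntidiagonal.antidiagonal m,
      ENNReal.ofReal (1 / s ^ (p.1 + 1)) * ∑' q : ℕ, negPolylogIntegral d p.2 (s + q) := by
  have hW : Measurable (negPolylog d) := (continuous_negPolylog d).measurable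
  rw [negPolylogIntegral_eq_lintegral_gammaTail _ _ hs]
  have e : ∀ u ∈ Ioi (0 : ℝ),
      ENNReal.ofReal (polylogKernel (d + 1) u) * ENNReal.ofReal (gammaTail m s u) =
        ∑ p ∈ Finset.HasAntidiagonal.antidiagonal m, ENNReal.ofReal (1 / s ^ (p.1 + 1)) *
          ∑' q : ℕ, ENNReal.ofReal (u ^ p.2 / (p.2.factorial : ℝ) *
            Real.exp (-((s + q) * u)) * negPolylog d u) := by
    intro u hu
    have hu0 : (0 : ℝ) < u := hu
    have hW0 := negPolylog_nonneg d hu0.le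
    rw [gammaTail, ENNReal.ofReal_sum_of_nonneg (fun p _ => by positivity), Finset.mul_sum]
    refine Finset.sum_congr rfl fun p _ => ?_
    rw [polylogKernel_succ d hu0, ENNReal.ofReal_mul hW0, ofReal_inv_one_sub_exp_neg hu0,
      ENNReal.ofReal_mul (by positivity), mul_left_comm]
    congr 1
    rw [← ENNReal.tsum_mul_left, ← ENNReal.tsum_mul_right]
    refine tsum_congr fun q => ?_
    rw [← ENNReal.ofReal_mul hW0, ← ENNReal.ofReal_mul (by positivity)]
    congr 1
    rw [add_mul, neg_add, Real.exp_add]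
    ring
  rw [setLIntegral_congr_fun measurableSet_Ioi e, lintegral_finsetSum _ fun p _ => by fun_prop]
  refine Finset.sum_congr rfl fun p _ => ?_
  rw [lintegral_const_mul _ (by fun_prop), lintegral_tsum fun q => by fun_prop]
  rfl

/-- Expanding the bound `(1 + t) ^ (d + 1)` binomially dominates the integrand by finitely many
Gamma integrands. -/
lemma integrableOn_pow_mul_exp_mul_negPolylog (d m : ℕ) {s : ℝ} (hs : 0 < s) :
    IntegrableOn (fun t : ℝ => t ^ m / (m.factorial : ℝ) * Real.exp (-(s * t)) * negPolylog d t)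
      (Ioi 0) := by
  have hW : Continuous (negPolylog d) := continuous_negPolylog d
  have h1 : IntegrableOn (fun t : ℝ => ∑ i ∈ Finset.range (d + 1 + 1),
      ((d + 1).choose i : ℝ) * ((m + i).factorial / (m.factorial : ℝ)) *
        (t ^ (m + i) / ((m + i).factorial : ℝ) * Real.exp (-(s * t)))) (Ioi 0) :=
    integrable_finsetSum _ fun i _ => (integrableOn_pow_mul_exp (m + i) hs le_rfl).const_mul _
  refine Integrable.mono' h1 (by fun_prop) ?_
  refine (ae_restrict_iff' measurableSet_Ioi).2 (Filter.Eventually.of_forall fun t ht => ?_)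
  have ht0 : (0 : ℝ) < t := ht
  have h2 := negPolylog_nonneg d ht0.le
  have h3 : 0 ≤ t ^ m / (m.factorial : ℝ) * Real.exp (-(s * t)) := by positivity
  rw [Real.norm_of_nonneg (mul_nonneg h3 h2)]
  refine (mul_le_mul_of_nonneg_left (negPolylog_le d ht0) h3).trans_eq ?_
  rw [add_comm 1 t, add_pow, Finset.mul_sum]
  refine Finset.sum_congr rfl fun i _ => ?_
  rw [pow_add]
  field_simp
  simp

lemma integral_pow_mul_exp_mul_negPolylog (d m : ℕ) (s : ℝ) :
    ∫ t in Ioi (0 : ℝ), t ^ m / (m.factorial : ℝ) * Real.exp (-(s * t)) * negPolylog d t =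
      (negPolylogIntegral d m s).toReal := by
  have hW : Continuous (negPolylog d) := continuous_negPolylog d
  rw [integral_eq_lintegral_of_nonneg_ae _ (by fun_prop), negPolylogIntegral]
  refine (ae_restrict_iff' measurableSet_Ioi).2 (Filter.Eventually.of_forall fun t ht => ?_)
  have ht0 : (0 : ℝ) < t := ht
  have := negPolylog_nonneg d ht0.le
  simp only [Pi.zero_apply]
  positivity

lemma negPolylogIntegral_ne_top (d m : ℕ) {s : ℝ} (hs : 0 < s) :
    negPolylogIntegral d m s ≠ ⊤ :=
  ((hasFiniteIntegral_iff_ofReal ((ae_restrict_iff' measurableSet_Ioi).2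
    (Filter.Eventually.of_forall fun t ht => by
      have ht0 : (0 : ℝ) < t := ht
      have := negPolylog_nonneg d ht0.le
      simp only [Pi.zero_apply]
      positivity))).1 (integrableOn_pow_mul_exp_mul_negPolylog d m hs).2).ne

lemma integral_pow_mul_exp_mul_negPolylog_zero (m : ℕ) {s : ℝ} (hs : 0 < s) :
    ∫ t in Ioi (0 : ℝ), t ^ m / (m.factorial : ℝ) * Real.exp (-(s * t)) * negPolylog 0 t =
      (m + 1) / s ^ (m + 2) := by
  rw [integral_pow_mul_exp_mul_negPolylog, negPolylogIntegral_zero m hs,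
    ENNReal.toReal_ofReal (by positivity)]

lemma integral_pow_mul_exp_mul_negPolylog_succ (d m : ℕ) {s : ℝ} (hs : 0 < s) :
    ∫ t in Ioi (0 : ℝ), t ^ m / (m.factorial : ℝ) * Real.exp (-(s * t)) * negPolylog (d + 1) t =
      ∑ a ∈ Finset.Nat.antidiagonalTuple (d + 1 + 1) m,
        ((a (Fin.last (d + 1)) : ℝ) + 1) * (1 / s ^ (a 0 + 1)) *
          hurwitzZetaStar (fun i : Fin (d + 1) =>
            if (i : ℕ) + 1 = d + 1 then a i.succ + 2 else a i.succ + 1) fun _ => s := by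
  have h := eq_sum_hurwitzZetaStarENN (fun m _ hs => negPolylogIntegral_zero m hs)
    (fun d m _ hs => negPolylogIntegral_succ d m hs) d m hs
  have htop := negPolylogIntegral_ne_top (d + 1) m hs
  rw [integral_pow_mul_exp_mul_negPolylog, h, ENNReal.toReal_sum]
  · refine Finset.sum_congr rfl fun a _ => ?_
    rw [ENNReal.toReal_mul, ENNReal.toReal_ofReal (by positivity),
      toReal_hurwitzZetaStarENN _ hs]
    rfl
  · rw [h] at htop
    -- Each summand is finite because the total, a convergent integral, is.
    exact fun a ha => ne_top_of_le_ne_top htop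
      (Finset.single_le_sum (f := fun a : Fin (d + 1 + 1) → ℕ => ENNReal.ofReal
        (((a (Fin.last (d + 1)) : ℝ) + 1) * (1 / s ^ (a 0 + 1))) *
          hurwitzZetaStarENN (starExponent fun i => a i.succ) s) (fun _ _ => zero_le) ha)

/-! ### The integrand and the main theorem -/

lemma integral_pow_mul_exp_mul_negPolylog_of_ne_zero {r : ℕ} (hr : r ≠ 0) (m : ℕ) {s : ℝ}
    (hs : 0 < s) :
    ∫ t in Ioi (0 : ℝ), t ^ m / (m.factorial : ℝ) * Real.exp (-(s * t)) * negPolylog r t =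
      ∑ a ∈ Finset.Nat.antidiagonalTuple (r + 1) m,
        ((a (Fin.last r) : ℝ) + 1) * (1 / s ^ (a 0 + 1)) *
          hurwitzZetaStar (fun i : Fin r =>
            if (i : ℕ) + 1 = r then a i.succ + 2 else a i.succ + 1) fun _ => s := by
  obtain ⟨d, rfl⟩ := Nat.exists_eq_succ_of_ne_zero hr
  exact integral_pow_mul_exp_mul_negPolylog_succ d m hs

lemma aeval_polyP'_one_sub_exp {k n l : ℕ} (hkn : k < n) (hl : l ≤ k) (t : ℝ) :
    aeval (1 - Complex.exp t) (polyP' k n l) / Complex.exp t ^ (n - l + 1) * Complex.exp t =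
      ((∑ j ∈ Finset.range (n - l),
        (coeffA' k n l j : ℝ) * Real.exp (-(((n : ℝ) - l - j) * t)) : ℝ) : ℂ) := by
  rw [aeval_polyP'_one_sub hkn hl, Finset.sum_div, Finset.sum_mul, Complex.ofReal_sum]
  refine Finset.sum_congr rfl fun j hj => ?_
  rw [Finset.mem_range] at hj
  obtain ⟨c, hc⟩ := Nat.exists_eq_add_of_lt hj
  have hn : (n : ℝ) = l + (j + c + 1) := by
    have : n = l + (j + c + 1) := by omega
    exact_mod_cast this
  have hw := Complex.exp_ne_zero (t : ℂ)
  have e : Real.exp (-(((n : ℝ) - l - j) * t)) = (Real.exp t ^ (c + 1))⁻¹ := by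
    rw [← Real.exp_nat_mul, ← Real.exp_neg, hn]
    congr 1
    push_cast
    ring
  rw [e, hc]
  push_cast
  rw [show j + c + 1 + 1 = j + (c + 1) + 1 by ring, pow_succ, pow_add]
  field_simp

lemma one_sub_exp_mul_polylogQuot (r : ℕ) {t : ℝ} (ht : 0 ≤ t) :
    (1 - Complex.exp t) * polylogQuot (r + 1) (1 - Complex.exp t) = -(negPolylog r t : ℂ) := by
  have h : 1 - Complex.exp t = ((1 - Real.exp t : ℝ) : ℂ) := by push_cast; rfl
  rw [h, polylogQuot_ofReal, negPolylog_eq r ht]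
  push_cast
  ring

/-- The integrand of `ξ̃(k,-n;m+1)` divided by `m!`, as a real function. -/
def xiTildeRealIntegrand (k n m : ℕ) (t : ℝ) : ℝ :=
  -(∑ l ∈ Finset.range k, ∑ j ∈ Finset.range (n - l), (coeffA' k n l j : ℝ) *
      (t ^ m / (m.factorial : ℝ) * Real.exp (-(((n : ℝ) - l - j) * t)) *
        negPolylog (k - l - 1) t)) -
    ∑ j ∈ Finset.range (n - k), (coeffA' k n k j : ℝ) *
      (t ^ m / (m.factorial : ℝ) * Real.exp (-(((n : ℝ) - k - j) * t)) -
        t ^ m / (m.factorial : ℝ) * Real.exp (-(((n : ℝ) - k - j + 1) * t)))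

/-- With `z = 1 - exp t`, the denominator is `z / exp t`. It cancels one `z` of `z ^ 2` and
contributes `exp t`; the other `z` turns `polylogQuot` into a polylogarithm, or for `l = k` yields
`-(1 - exp (-t))`. -/
lemma doublePolylog_one_sub_exp_div {k n : ℕ} (hkn : k < n) {t : ℝ} (ht : 0 < t) :
    doublePolylog (k : ℤ) (-(n : ℤ)) (1 - Complex.exp t) / (Complex.exp (-(t : ℂ)) - 1) =
      ((-(∑ l ∈ Finset.range k, (∑ j ∈ Finset.range (n - l),
          (coeffA' k n l j : ℝ) * Real.exp (-(((n : ℝ) - l - j) * t))) * negPolylog (k - l - 1) t) -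
        (∑ j ∈ Finset.range (n - k),
          (coeffA' k n k j : ℝ) * Real.exp (-(((n : ℝ) - k - j) * t))) * (1 - Real.exp (-t)) : ℝ) :
        ℂ) := by
  have hz : 1 - Complex.exp t ∈ cutPlane := by
    have h := ofReal_mem_cutPlane (one_sub_exp_nonpos ht.le)
    push_cast at h
    exact h
  have hw := Complex.exp_ne_zero (t : ℂ)
  have hz0 : 1 - Complex.exp t ≠ 0 := by
    have h : 1 - Real.exp t ≠ 0 := by
      have := Real.one_lt_exp_iff.2 ht
      linarith
    exact_mod_cast h
  have hd : Complex.exp (-(t : ℂ)) - 1 = (1 - Complex.exp t) / Complex.exp t := by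
    rw [Complex.exp_neg]
    field_simp
  rw [doublePolylog_eq_closed hkn hz, doublePolylogClosed, add_div, Finset.sum_div,
    sub_sub_cancel, Complex.ofReal_sub, Complex.ofReal_neg, Complex.ofReal_sum, sub_eq_add_neg (-_),
    ← Finset.sum_neg_distrib]
  congr 1
  · refine Finset.sum_congr rfl fun l hl => ?_
    rw [Finset.mem_range] at hl
    have h1 := one_sub_exp_mul_polylogQuot (k - l - 1) ht.le
    rw [show k - l - 1 + 1 = k - l by omega] at h1
    rw [Complex.ofReal_mul, ← aeval_polyP'_one_sub_exp hkn hl.le, ← mul_neg, ← h1, hd]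
    field_simp
  · rw [Complex.ofReal_mul, ← aeval_polyP'_one_sub_exp hkn le_rfl]
    have h1 : ((1 - Real.exp (-t) : ℝ) : ℂ) = -(Complex.exp (-(t : ℂ)) - 1) := by
      push_cast
      ring
    rw [h1, hd]
    field_simp
    ring

lemma xiTildeIntegrand_eq {k n : ℕ} (hkn : k < n) (m : ℕ) {t : ℝ} (ht : 0 < t) :
    xiTildeIntegrand k n ((m : ℂ) + 1) t =
      (m.factorial : ℂ) * (xiTildeRealIntegrand k n m t : ℂ) := by
  have hm : (m.factorial : ℝ) ≠ 0 := by positivity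
  rw [xiTildeIntegrand, doublePolylog_one_sub_exp_div hkn ht, add_sub_cancel_right,
    Complex.cpow_natCast, ← Complex.ofReal_pow, ← Complex.ofReal_mul, ← Complex.ofReal_natCast,
    ← Complex.ofReal_mul]
  congr 1
  rw [xiTildeRealIntegrand, mul_sub (t ^ m), mul_sub (m.factorial : ℝ), mul_neg, mul_neg]
  refine congrArg₂ (· - ·) (congrArg _ ?_) ?_
  · simp only [Finset.mul_sum, Finset.sum_mul]
    refine Finset.sum_congr rfl fun l _ => Finset.sum_congr rfl fun j _ => ?_
    field_simp
  · simp only [Finset.mul_sum, Finset.sum_mul]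
    refine Finset.sum_congr rfl fun j _ => ?_
    rw [add_mul _ (1 : ℝ), neg_add, Real.exp_add, one_mul]
    field_simp

lemma sub_sub_pos {n l j : ℕ} (hj : j < n - l) : 0 < (n : ℝ) - l - j := by
  have h : ((l + j : ℕ) : ℝ) < n := by exact_mod_cast (by omega : l + j < n)
  push_cast at h
  linarith

lemma integrableOn_xiTildeRealIntegrand (k n m : ℕ) :
    IntegrableOn (xiTildeRealIntegrand k n m) (Ioi 0) := by
  unfold xiTildeRealIntegrand
  refine Integrable.sub (Integrable.neg (integrable_finsetSum _ fun l _ =>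
    integrable_finsetSum _ fun j hj => Integrable.const_mul ?_ _))
    (integrable_finsetSum _ fun j hj => Integrable.const_mul (Integrable.sub ?_ ?_) _)
  · exact integrableOn_pow_mul_exp_mul_negPolylog _ _ (sub_sub_pos (Finset.mem_range.1 hj))
  · exact integrableOn_pow_mul_exp _ (sub_sub_pos (Finset.mem_range.1 hj)) le_rfl
  · exact integrableOn_pow_mul_exp _ (by linarith [sub_sub_pos (Finset.mem_range.1 hj)]) le_rfl

lemma integral_xiTildeRealIntegrand (k n m : ℕ) :
    ∫ t in Ioi (0 : ℝ), xiTildeRealIntegrand k n m t =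
      -(∑ l ∈ Finset.range k, ∑ j ∈ Finset.range (n - l), (coeffA' k n l j : ℝ) *
        ∫ t in Ioi (0 : ℝ), t ^ m / (m.factorial : ℝ) * Real.exp (-(((n : ℝ) - l - j) * t)) *
          negPolylog (k - l - 1) t) -
      ∑ j ∈ Finset.range (n - k), (coeffA' k n k j : ℝ) *
        (1 / ((n : ℝ) - k - j) ^ (m + 1) - 1 / ((n : ℝ) - k - j + 1) ^ (m + 1)) := by
  have h1 : ∀ l, ∀ j ∈ Finset.range (n - l), Integrable (fun t : ℝ => (coeffA' k n l j : ℝ) *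
      (t ^ m / (m.factorial : ℝ) * Real.exp (-(((n : ℝ) - l - j) * t)) *
        negPolylog (k - l - 1) t)) (volume.restrict (Ioi 0)) := fun l j hj =>
    (integrableOn_pow_mul_exp_mul_negPolylog _ _ (sub_sub_pos (Finset.mem_range.1 hj))).const_mul _
  have h2 : ∀ j ∈ Finset.range (n - k), Integrable (fun t : ℝ =>
      t ^ m / (m.factorial : ℝ) * Real.exp (-(((n : ℝ) - k - j) * t)))
      (volume.restrict (Ioi 0)) := fun j hj =>
    integrableOn_pow_mul_exp _ (sub_sub_pos (Finset.mem_range.1 hj)) le_rfl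
  have h3 : ∀ j ∈ Finset.range (n - k), Integrable (fun t : ℝ =>
      t ^ m / (m.factorial : ℝ) * Real.exp (-(((n : ℝ) - k - j + 1) * t)))
      (volume.restrict (Ioi 0)) := fun j hj =>
    integrableOn_pow_mul_exp _ (by linarith [sub_sub_pos (Finset.mem_range.1 hj)]) le_rfl
  have h4 : ∀ j ∈ Finset.range (n - k), Integrable (fun t : ℝ => (coeffA' k n k j : ℝ) *
      (t ^ m / (m.factorial : ℝ) * Real.exp (-(((n : ℝ) - k - j) * t)) -
        t ^ m / (m.factorial : ℝ) * Real.exp (-(((n : ℝ) - k - j + 1) * t))))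
      (volume.restrict (Ioi 0)) := fun j hj => ((h2 j hj).sub (h3 j hj)).const_mul _
  unfold xiTildeRealIntegrand
  rw [integral_sub (Integrable.fun_neg (integrable_finsetSum _ fun l _ =>
    integrable_finsetSum _ (h1 l))) (integrable_finsetSum _ h4), integral_neg,
    integral_finsetSum _ fun l _ => integrable_finsetSum _ (h1 l), integral_finsetSum _ h4]
  refine congrArg₂ (· - ·) (congrArg _ ?_) ?_
  · refine Finset.sum_congr rfl fun l _ => ?_
    rw [integral_finsetSum _ (h1 l)]
    exact Finset.sum_congr rfl fun j _ => integral_const_mul _ _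
  · refine Finset.sum_congr rfl fun j hj => ?_
    have hpos := sub_sub_pos (Finset.mem_range.1 hj)
    rw [integral_const_mul, integral_sub (h2 j hj) (h3 j hj),
      integral_pow_mul_exp m hpos le_rfl, integral_pow_mul_exp m (by linarith) le_rfl,
      gammaTail_zero_right, gammaTail_zero_right]

lemma xiTilde_eq_integral {k n : ℕ} (hkn : k < n) (m : ℕ) :
    xiTilde k n ((m : ℂ) + 1) = ((∫ t in Ioi (0 : ℝ), xiTildeRealIntegrand k n m t : ℝ) : ℂ) := by
  have hm : (m.factorial : ℂ) ≠ 0 := by exact_mod_cast m.factorial_ne_zero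
  rw [xiTilde, Complex.Gamma_nat_eq_factorial, setIntegral_congr_fun measurableSet_Ioi
    fun t ht => xiTildeIntegrand_eq hkn m ht, integral_const_mul, integral_complex_ofReal]
  field_simp

theorem mainTheorem5 (k n : ℕ) (hk : 1 ≤ k) (hkn : k < n) (m : ℕ) :
    IsDoublePolylogContinuation (k : ℤ) (-(n : ℤ)) (doublePolylog (k : ℤ) (-(n : ℤ))) ∧
    IntegrableOn (xiTildeIntegrand k n ((m : ℂ) + 1)) (Ioi (0 : ℝ)) volume ∧
    xiTilde k n ((m : ℂ) + 1) =
      ((-(∑ l ∈ Finset.range (k - 1), ∑ j ∈ Finset.range (n - l),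
            -- the tuple `a` is `(a_{l+1}, …, a_k)`, so `a 0 = a_{l+1}`, `a i.succ = a_{l+2+i}`
            ∑ a ∈ Finset.Nat.antidiagonalTuple (k - l - 1 + 1) m,
              (coeffA' k n l j : ℝ) * ((a (Fin.last (k - l - 1)) : ℝ) + 1) *
                (1 / ((n : ℝ) - l - j) ^ (a 0 + 1)) *
                hurwitzZetaStar
                  (fun i : Fin (k - l - 1) =>
                    if (i : ℕ) + 1 = k - l - 1 then a i.succ + 2 else a i.succ + 1)
                  (fun _ : Fin (k - l - 1) => (n : ℝ) - l - j))
        - ∑ j ∈ Finset.range (n - k + 1),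
            (coeffA' k n (k - 1) j : ℝ) * (((m : ℝ) + 1) / ((n : ℝ) - k - j + 1) ^ (m + 2))
        - ∑ j ∈ Finset.range (n - k),
            (coeffA' k n k j : ℝ) *
              (1 / ((n : ℝ) - k - j) ^ (m + 1) - 1 / ((n : ℝ) - k - j + 1) ^ (m + 1)) : ℝ) : ℂ) := by
  refine ⟨isDoublePolylogContinuation_doublePolylog hkn, ?_, ?_⟩
  · refine IntegrableOn.congr_fun ?_ (fun t ht => (xiTildeIntegrand_eq hkn m ht).symm)
      measurableSet_Ioi
    exact (integrableOn_xiTildeRealIntegrand k n m).ofReal.const_mul _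
  · rw [xiTilde_eq_integral hkn, integral_xiTildeRealIntegrand, Complex.ofReal_inj]
    obtain ⟨c, rfl⟩ := Nat.exists_eq_add_of_le' hk
    -- The term `l = k - 1` is split off: there `negPolylog 0 t = t`, so the integral is elementary
    -- and no star value occurs.
    rw [Finset.sum_range_succ, neg_add, ← sub_eq_add_neg]
    refine congrArg₂ (· - ·) (congrArg₂ (· - ·) (congrArg _ ?_) ?_) rfl
    · refine Finset.sum_congr rfl fun l hl => Finset.sum_congr rfl fun j hj => ?_
      rw [Nat.add_sub_cancel, Finset.mem_range] at hl
      rw [integral_pow_mul_exp_mul_negPolylog_of_ne_zero (by omega) m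
        (sub_sub_pos (Finset.mem_range.1 hj)), Finset.mul_sum]
      exact Finset.sum_congr rfl fun a _ => by ring
    · rw [Nat.add_sub_cancel, show n - (c + 1) + 1 = n - c by omega]
      refine Finset.sum_congr rfl fun j hj => ?_
      rw [show c + 1 - c - 1 = 0 by omega, integral_pow_mul_exp_mul_negPolylog_zero m
        (sub_sub_pos (Finset.mem_range.1 hj))]
      push_cast
      rw [show (n : ℝ) - (c + 1) - j + 1 = n - c - j by ring]

end
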